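/- Conventions. For $1\le r\le\infty$ let $r'$ be the conjugate exponent, $\frac1r+\frac1{r'}=1$, and let $\|\cdot\|_r$ be the norm of $L^r(\mathbb R^n)$ with respect to Lebesgue measure. The Fourier transform is $\widehat f(y)=\int_{\mathbb R^n}f(x)e^{-2\pi i x\cdot y}\,dx$ for Schwartz functions, and is extended to functions in $L^r$, $1\le r\le\infty$, in the sense of tempered distributions: $\langle\widehat f,\psi\rangle=\int f\,\widehat\psi\,dx$ for all Schwartz $\psi$. Let $$\widehat L^{r}(\mathbb R^n)=\{h\in L^{r}(\mathbb R^n): h=\widehat g\ \text{for some } g\in L^{r'}(\mathbb R^n)\},\qquad \|h\|_{\widehat L^{r}}=\|\widehat h\|_{r'} .$$ For a finite complex Borel measure $\mu$ on $\mathbb R^n$ and $1\le p\le\infty$ put $$\|\mu\|_p^*=\sup\Big\{\Big|\int_{\mathbb R^n}h\,d\mu\Big| : h\in\widehat L^{p'}(\mathbb R^n)\ \text{continuous and } |\mu|\text{-integrable},\ \|h\|_{\widehat L^{p'}}\le 1\Big\}\in[0,\infty],$$ write $\mu\in\mathcal M_p$ if $\|\mu\|_p^*<\infty$, and let $\widehat\mu(y)=\int_{\mathbb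 R^n}e^{-2\pi i x\cdot y}\,d\mu(x)$. Proposition (Hausdorff–Young inequality for measures). Let $1\le p\le 2$ and let $\mu$ be a finite complex Borel measure on $\mathbb R^n$ with $\mu\in\mathcal M_p$. Then $\widehat\mu\in L^{p'}(\mathbb R^n)$ and $$\|\widehat\mu\|_{p'}\le\|\mu\|_p^* .$$ -/

import Mathlib

open MeasureTheory Real
open scoped ENNReal SchwartzMap FourierTransform

noncomputable section

/-- `ℝⁿ` with its Euclidean norm. -/
abbrev RSpace (n : ℕ) : Type := EuclideanSpace ℝ (Fin n)

/-- `h = ĝ` in the sense of distributions: `⟨h, ψ⟩ = ∫ g ψ̂` for all Schwartz functions `ψ`, where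
`ψ̂ (y) = ∫ ψ(x) exp (-2 π i x · y) dx`. It is only used for functions `g`, `h` that belong to some
`L^r`, `1 ≤ r ≤ ∞`, for which both integrals converge. -/
def IsDistribFourier {n : ℕ} (g h : RSpace n → ℂ) : Prop :=
  ∀ ψ : 𝓢(RSpace n, ℂ), ∫ x, h x * ψ x = ∫ x, g x * (𝓕 ψ) x

/-- Membership in `L̂^p(ℝⁿ) = {h ∈ L^p : h = ĝ for some g ∈ L^{p'}}`. -/
def MemHatLp {n : ℕ} (p : ℝ≥0∞) (h : RSpace n → ℂ) : Prop :=
  MemLp h p volume ∧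
    ∃ g : RSpace n → ℂ, MemLp g (ENNReal.conjExponent p) volume ∧ IsDistribFourier g h

/-- The norm `‖h‖_{L̂^p} = ‖ĥ‖_{p'}`. The function `ĥ` is unique up to null sets, so that the
infimum is over a single value; it is `∞` if the distribution `ĥ` is not a function in `L^{p'}`. -/
def hatNorm {n : ℕ} (p : ℝ≥0∞) (h : RSpace n → ℂ) : ℝ≥0∞ :=
  ⨅ (k : RSpace n → ℂ) (_ : MemLp k (ENNReal.conjExponent p) volume ∧ IsDistribFourier h k),
    eLpNorm k (ENNReal.conjExponent p) volume

/-- The integral `∫ f dμ` of a complex function against a complex measure. -/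
def cintegral {n : ℕ} (μ : ComplexMeasure (RSpace n)) (f : RSpace n → ℂ) : ℂ :=
  VectorMeasure.integral μ f (ContinuousLinearMap.mul ℝ ℂ)

/-- `‖μ‖_p^*`, the supremum of `|∫ h dμ|` over the `h ∈ L̂^{p'}` with `‖h‖_{L̂^{p'}} ≤ 1`. As `μ` may
be singular, `∫ h dμ` has a meaning only for a distinguished representative of the class `h`: the
supremum is over the continuous, `μ`-integrable ones. -/
def starNorm {n : ℕ} (p : ℝ≥0∞) (μ : ComplexMeasure (RSpace n)) : ℝ≥0∞ :=
  ⨆ (h : RSpace n → ℂ) (_ : Continuous h ∧ VectorMeasure.Integrable μ h ∧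
      MemHatLp (ENNReal.conjExponent p) h ∧ hatNorm (ENNReal.conjExponent p) h ≤ 1),
    ‖cintegral μ h‖ₑ

/-- The finite complex Borel measures `μ` with `‖μ‖_p^* < ∞`. -/
def MSpace (n : ℕ) (p : ℝ≥0∞) : Set (ComplexMeasure (RSpace n)) :=
  {μ | starNorm p μ < ∞}

/-- The Fourier transform `μ̂ (y) = ∫ exp (-2 π i x · y) dμ(x)` of a finite complex measure. -/
def fourierMeasure {n : ℕ} (μ : ComplexMeasure (RSpace n)) (y : RSpace n) : ℂ :=
  cintegral μ (fun x => Complex.exp (-(2 * π * inner ℝ x y : ℝ) * Complex.I))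

end

/-! The argument is duality and needs no interpolation. For Schwartz `φ` the function `φ̂` is a
competitor in the supremum defining `‖μ‖_p^*` once `‖φ‖_p ≤ 1`, because its own Fourier transform is
`φ(-·)`, of norm `‖φ‖_p`. Fubini gives `∫ φ̂ dμ = ∫ φ μ̂`, whence `|∫ φ μ̂| ≤ ‖μ‖_p^* ‖φ‖_p`
(`enorm_integral_mul_fourierMeasure_le`). As `μ̂` is continuous, the bound passes to test functions
in `C_c` (`enorm_integral_mul_le_of_forall_schwartz`). Testing against truncations of `|μ̂|^{p'-2}`
times the conjugate of `μ̂` then yields the `L^{p'}` bound; `p ≤ 2` keeps that function continuous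
at the zeros of `μ̂`. The case `p = 1` is a pointwise argument. -/

/-! ### Integration against a complex measure, reduced to finite positive measures -/

/-- The vector measure `s ↦ ρ(s) c`. -/
noncomputable def MeasureTheory.Measure.smulVectorMeasure {X F : Type*} [MeasurableSpace X]
    [NormedAddCommGroup F] [NormedSpace ℝ F] (ρ : Measure X) [IsFiniteMeasure ρ] (c : F) :
    VectorMeasure X F :=
  ρ.toSignedMeasure.mapRange
    (ContinuousLinearMap.toSpanSingleton ℝ c).toLinearMap.toAddMonoidHom
    (ContinuousLinearMap.toSpanSingleton ℝ c).continuous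

section
variable {X F : Type*} [MeasurableSpace X] [NormedAddCommGroup F] [NormedSpace ℝ F]
  (ρ : Measure X) [IsFiniteMeasure ρ] (c : F)

lemma MeasureTheory.Measure.smulVectorMeasure_apply {s : Set X} (hs : MeasurableSet s) :
    ρ.smulVectorMeasure c s = ρ.real s • c := by
  simp [Measure.smulVectorMeasure, VectorMeasure.mapRange_apply,
    Measure.toSignedMeasure_apply_measurable hs]

lemma MeasureTheory.Measure.variation_smulVectorMeasure_le :
    (ρ.smulVectorMeasure c).variation ≤ ‖c‖ₑ • ρ := by
  apply VectorMeasure.variation_le_of_forall_enorm_le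
  intro s hs
  rw [ρ.smulVectorMeasure_apply c hs, enorm_smul, Measure.smul_apply, smul_eq_mul, mul_comm,
    Real.enorm_of_nonneg measureReal_nonneg, ofReal_measureReal]

lemma MeasureTheory.Integrable.smulVectorMeasure {E : Type*} [NormedAddCommGroup E] {f : X → E}
    (hf : Integrable f ρ) : (ρ.smulVectorMeasure c).Integrable f :=
  Integrable.of_measure_le_smul enorm_ne_top (ρ.variation_smulVectorMeasure_le c) hf

/-- Since the variation is at most `‖c‖ₑ • ρ`, the integral may be computed by `setToFun` over `ρ`;
both sides are then continuous on `L¹(ρ)` and agree on indicators. -/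
lemma MeasureTheory.Measure.vectorIntegral_smulVectorMeasure (c : ℂ) {f : X → ℂ}
    (hf : Integrable f ρ) :
    VectorMeasure.integral (ρ.smulVectorMeasure c) f (ContinuousLinearMap.mul ℝ ℂ) =
      (∫ x, f x ∂ρ) * c := by
  have h1 : DominatedFinMeasAdditive ρ
      ((ρ.smulVectorMeasure c).transpose (ContinuousLinearMap.mul ℝ ℂ)) ‖c‖ := by
    refine ⟨fun s t hs ht _ _ hdisj ↦
      cbmApplyMeasure_union (ρ.smulVectorMeasure c) (ContinuousLinearMap.mul ℝ ℂ) hs ht hdisj, fun s hs hsf ↦ ?_⟩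
    refine ContinuousLinearMap.opNorm_le_bound _ (by positivity) fun z ↦ ?_
    change ‖z * (ρ.smulVectorMeasure c s)‖ ≤ _
    rw [ρ.smulVectorMeasure_apply c hs, norm_mul, norm_smul, Real.norm_of_nonneg measureReal_nonneg]
    exact le_of_eq (by ring)
  rw [VectorMeasure.integral_eq_setToFun,
    ← setToFun_congr_measure_of_integrable ‖c‖ₑ enorm_ne_top (ρ.variation_smulVectorMeasure_le c)
      h1 _ f hf]
  refine hf.induction (P := fun f ↦ setToFun ρ
    ((ρ.smulVectorMeasure c).transpose (ContinuousLinearMap.mul ℝ ℂ)) h1 f =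
      (∫ x, f x ∂ρ) * c) ?_ ?_ ?_ ?_
  · intro z s hs hρs
    rw [setToFun_indicator_const h1 hs hρs.ne, integral_indicator_const z hs]
    change z * (ρ.smulVectorMeasure c s) = _
    rw [ρ.smulVectorMeasure_apply c hs, Complex.real_smul, Complex.real_smul]
    ring
  · intro f g _ hf hg hf' hg'
    rw [setToFun_add h1 hf hg, hf', hg', integral_add' hf hg, add_mul]
  · exact isClosed_eq (continuous_setToFun h1) (continuous_integral.mul continuous_const)
  · intro f g hfg _ hf'
    rw [← setToFun_congr_ae h1 hfg, hf', integral_congr_ae hfg]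

end

lemma MeasureTheory.ComplexMeasure.eq_sum_smulVectorMeasure {X : Type*} [MeasurableSpace X]
    (μ : ComplexMeasure X) :
    μ = (ComplexMeasure.re μ).toJordanDecomposition.posPart.smulVectorMeasure (1 : ℂ) +
      (ComplexMeasure.re μ).toJordanDecomposition.negPart.smulVectorMeasure (-1 : ℂ) +
      (ComplexMeasure.im μ).toJordanDecomposition.posPart.smulVectorMeasure Complex.I +
      (ComplexMeasure.im μ).toJordanDecomposition.negPart.smulVectorMeasure (-Complex.I) := by
  have key : ∀ (σ : SignedMeasure X) {s : Set X}, MeasurableSet s → σ s =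
      σ.toJordanDecomposition.posPart.real s - σ.toJordanDecomposition.negPart.real s := by
    intro σ s hs
    conv_lhs => rw [← σ.toSignedMeasure_toJordanDecomposition]
    simp [JordanDecomposition.toSignedMeasure, Measure.toSignedMeasure_apply_measurable hs]
  ext s hs
  have h1 := key (ComplexMeasure.re μ) hs
  have h2 := key (ComplexMeasure.im μ) hs
  have h1' : (μ s).re = ComplexMeasure.re μ s := rfl
  have h2' : (μ s).im = ComplexMeasure.im μ s := rfl
  simp only [add_apply, Measure.smulVectorMeasure_apply _ _ hs]
  apply Complex.ext
  · rw [h1', h1]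
    simp [-ComplexMeasure.re_apply, sub_eq_add_neg]
  · rw [h2', h2]
    simp [-ComplexMeasure.im_apply, sub_eq_add_neg]


/-- Every complex measure is a combination of four finite measures, and so is the integral. -/
lemma exists_cintegral_eq {n : ℕ} (μ : ComplexMeasure (RSpace n)) :
    ∃ (ρ : Fin 4 → Measure (RSpace n)) (c : Fin 4 → ℂ), (∀ i, IsFiniteMeasure (ρ i)) ∧
      ∀ f : RSpace n → ℂ, (∀ i, Integrable f (ρ i)) →
        VectorMeasure.Integrable μ f ∧ cintegral μ f = ∑ i, (∫ x, f x ∂ρ i) * c i := by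
  refine ⟨![(ComplexMeasure.re μ).toJordanDecomposition.posPart,
    (ComplexMeasure.re μ).toJordanDecomposition.negPart,
    (ComplexMeasure.im μ).toJordanDecomposition.posPart,
    (ComplexMeasure.im μ).toJordanDecomposition.negPart], ![1, -1, Complex.I, -Complex.I],
    ?_, fun f hf ↦ ?_⟩
  · intro i
    fin_cases i
    · exact (ComplexMeasure.re μ).toJordanDecomposition.posPart_finite
    · exact (ComplexMeasure.re μ).toJordanDecomposition.negPart_finite
    · exact (ComplexMeasure.im μ).toJordanDecomposition.posPart_finite
    · exact (ComplexMeasure.im μ).toJordanDecomposition.negPart_finite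
  · have f0 : Integrable f (ComplexMeasure.re μ).toJordanDecomposition.posPart := hf 0
    have f1 : Integrable f (ComplexMeasure.re μ).toJordanDecomposition.negPart := hf 1
    have f2 : Integrable f (ComplexMeasure.im μ).toJordanDecomposition.posPart := hf 2
    have f3 : Integrable f (ComplexMeasure.im μ).toJordanDecomposition.negPart := hf 3
    have h0 := f0.smulVectorMeasure _ (1 : ℂ)
    have h1 := f1.smulVectorMeasure _ (-1 : ℂ)
    have h2 := f2.smulVectorMeasure _ Complex.I
    have h3 := f3.smulVectorMeasure _ (-Complex.I)
    have h01 := h0.add_vectorMeasure h1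
    have h012 := h01.add_vectorMeasure h2
    constructor
    · rw [ComplexMeasure.eq_sum_smulVectorMeasure μ]
      exact h012.add_vectorMeasure h3
    · unfold cintegral
      conv_lhs => rw [ComplexMeasure.eq_sum_smulVectorMeasure μ]
      rw [VectorMeasure.integral_add_vectorMeasure h012 h3,
        VectorMeasure.integral_add_vectorMeasure h01 h2,
        VectorMeasure.integral_add_vectorMeasure h0 h1,
        Measure.vectorIntegral_smulVectorMeasure _ _ f0,
        Measure.vectorIntegral_smulVectorMeasure _ _ f1,
        Measure.vectorIntegral_smulVectorMeasure _ _ f2,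
        Measure.vectorIntegral_smulVectorMeasure _ _ f3, Fin.sum_univ_four]
      rfl

/-! ### Converse Hölder inequality for continuous functions -/

section
variable {E : Type*} [NormedAddCommGroup E] [NormedSpace ℝ E] [FiniteDimensional ℝ E]
  [MeasurableSpace E] [BorelSpace E] {ν : Measure E} [IsFiniteMeasureOnCompacts ν]

/-- An `L^p` bound for the functional given by a continuous function extends from Schwartz functions
to continuous functions with compact support. -/
lemma enorm_integral_mul_le_of_forall_schwartz {f : E → ℂ} (hf : Continuous f) {p : ℝ≥0∞}
    (hp1 : 1 ≤ p) (hp : p ≠ ∞) {C : ℝ≥0∞} (hC : C ≠ ∞)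
    (h : ∀ φ : 𝓢(E, ℂ), ‖∫ y, φ y * f y ∂ν‖ₑ ≤ C * eLpNorm φ p ν)
    {g : E → ℂ} (hg : Continuous g) (hgc : HasCompactSupport g) :
    ‖∫ y, g y * f y ∂ν‖ₑ ≤ C * eLpNorm g p ν := by
  set K := tsupport g with hK
  have hKm : MeasurableSet K := hgc.measurableSet
  have hI : ∫⁻ y in K, ‖f y‖ₑ ∂ν ≠ ∞ := (hf.continuousOn.integrableOn_compact hgc).2.ne
  -- `D` collects the two errors, both linear in `ε`: that of the `L^p` norm and that of the
  -- integral.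
  set D := C * ν K ^ (1 / p.toReal) + ∫⁻ y in K, ‖f y‖ₑ ∂ν with hD
  have hDt : D ≠ ∞ := by
    have : ν K ≠ ∞ := hgc.measure_lt_top.ne
    have : ν K ^ (1 / p.toReal) ≠ ∞ := ENNReal.rpow_ne_top_of_nonneg (by positivity) this
    finiteness
  have key : ∀ ε : ℝ, 0 < ε →
      ‖∫ y, g y * f y ∂ν‖ₑ ≤ C * eLpNorm g p ν + ENNReal.ofReal ε * D := by
    intro ε hε
    -- The smooth uniform approximation has support inside that of `g`, so every error lives on the
    -- compact set `K`.
    obtain ⟨φ, hφ, hφg, hφs⟩ := hg.exists_contDiff_approx ⊤ (ε := fun _ ↦ ε) (by fun_prop)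
      (by intro; positivity)
    have hφc : HasCompactSupport φ := hgc.mono hφs
    have hφK : φ.support ⊆ K := hφs.trans (subset_tsupport g)
    have h1 : ‖∫ y, φ y * f y ∂ν‖ₑ ≤ C * eLpNorm φ p ν := h (hφc.toSchwartzMap hφ)
    have h2 : eLpNorm (φ - g) p ν ≤ ENNReal.ofReal ε * ν K ^ (1 / p.toReal) :=
      eLpNorm_sub_le_of_dist_bdd ν hp hKm hε.le (fun x ↦ (hφg x).le) hφK (subset_tsupport g)
    have h3 : eLpNorm φ p ν ≤ eLpNorm g p ν + ENNReal.ofReal ε * ν K ^ (1 / p.toReal) := by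
      calc eLpNorm φ p ν = eLpNorm (g + (φ - g)) p ν := by simp
        _ ≤ eLpNorm g p ν + eLpNorm (φ - g) p ν :=
          eLpNorm_add_le hg.aestronglyMeasurable
            (hφ.continuous.aestronglyMeasurable.sub hg.aestronglyMeasurable) hp1
        _ ≤ _ := by gcongr
    have h4 : ‖∫ y, (g y - φ y) * f y ∂ν‖ₑ ≤ ENNReal.ofReal ε * ∫⁻ y in K, ‖f y‖ₑ ∂ν := by
      refine (enorm_integral_le_lintegral_enorm _).trans ?_
      rw [← lintegral_const_mul' _ _ ENNReal.ofReal_ne_top, ← lintegral_indicator hKm]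
      refine lintegral_mono fun y ↦ ?_
      by_cases hy : y ∈ K
      · rw [Set.indicator_of_mem hy, enorm_mul]
        gcongr
        rw [← ofReal_norm, ← dist_eq_norm, dist_comm]
        exact ENNReal.ofReal_le_ofReal (hφg y).le
      · have e1 : g y = 0 := image_eq_zero_of_notMem_tsupport hy
        have e2 : φ y = 0 := Function.notMem_support.1 fun h ↦ hy (hφK h)
        simp [e1, e2]
    have hi1 : Integrable (fun y ↦ (g y - φ y) * f y) ν :=
      Continuous.integrable_of_hasCompactSupport
        ((hg.sub hφ.continuous).mul hf) ((hgc.sub hφc).mul_right)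
    have hi2 : Integrable (fun y ↦ φ y * f y) ν :=
      Continuous.integrable_of_hasCompactSupport (hφ.continuous.mul hf) hφc.mul_right
    have h5 : ∫ y, g y * f y ∂ν = ∫ y, (g y - φ y) * f y ∂ν + ∫ y, φ y * f y ∂ν := by
      rw [← integral_add hi1 hi2]
      simp [sub_mul]
    rw [h5]
    calc _ ≤ _ := enorm_add_le _ _
      _ ≤ ENNReal.ofReal ε * ∫⁻ y in K, ‖f y‖ₑ ∂ν
          + C * (eLpNorm g p ν + ENNReal.ofReal ε * ν K ^ (1 / p.toReal)) := by
        gcongr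
        exact h1.trans (by gcongr)
      _ = _ := by rw [hD]; ring
  have hlim : Filter.Tendsto (fun ε : ℝ ↦ C * eLpNorm g p ν + ENNReal.ofReal ε * D)
      (nhdsWithin 0 (Set.Ioi 0)) (nhds (C * eLpNorm g p ν + ENNReal.ofReal 0 * D)) := by
    refine Filter.Tendsto.mono_left ?_ nhdsWithin_le_nhds
    exact tendsto_const_nhds.add (ENNReal.Tendsto.mul_const
      (ENNReal.continuous_ofReal.tendsto 0) (.inr hDt))
  refine ge_of_tendsto (hlim.trans (by simp)) ?_
  filter_upwards [self_mem_nhdsWithin] with ε hε using key ε hε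

/-- If `|f(x₀)| > C`, take a bump `χ` with `χ(x₀) = 1` that vanishes off `{|f| > C}` and test with
`χ` times the conjugate of `f`: then `∫ χ|f|² ≤ C ∫ χ|f|`, although `∫ χ|f|(|f| - C) > 0`. -/
lemma eLpNorm_top_le_of_forall_integral_mul_le [ν.IsOpenPosMeasure] {f : E → ℂ}
    (hf : Continuous f) {C : ℝ≥0∞}
    (h : ∀ g : E → ℂ, Continuous g → HasCompactSupport g →
      ‖∫ y, g y * f y ∂ν‖ₑ ≤ C * eLpNorm g 1 ν) :
    eLpNorm f ∞ ν ≤ C := by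
  rcases eq_or_ne C ∞ with rfl | hC
  · exact le_top
  lift C to NNReal using hC
  rw [eLpNorm_exponent_top]
  refine eLpNormEssSup_le_of_ae_nnnorm_bound (.of_forall fun x₀ ↦ ?_)
  by_contra! hx
  have hU : IsOpen {x | C < ‖f x‖₊} := isOpen_lt continuous_const hf.nnnorm
  obtain ⟨χ, hχ1, hχ0, hχc, hχ⟩ := exists_continuous_one_zero_of_isCompact
    (isCompact_singleton (x := x₀)) hU.isClosed_compl (by simpa using hx)
  have hg : Continuous fun y ↦ (χ y : ℂ) * (starRingEnd ℂ) (f y) := by fun_prop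
  have hχc' : HasCompactSupport fun y ↦ (χ y : ℂ) := hχc.comp_left (g := ((↑) : ℝ → ℂ)) rfl
  have h1 := h _ hg hχc'.mul_right
  have e1 : ∫ y, (χ y : ℂ) * (starRingEnd ℂ) (f y) * f y ∂ν
      = ((∫ y, χ y * ‖f y‖ ^ 2 ∂ν : ℝ) : ℂ) := by
    rw [← integral_complex_ofReal]
    congr 1 with y
    rw [mul_assoc, Complex.conj_mul']
    push_cast
    rfl
  have e2 : eLpNorm (fun y ↦ (χ y : ℂ) * (starRingEnd ℂ) (f y)) 1 ν
      = ENNReal.ofReal (∫ y, χ y * ‖f y‖ ∂ν) := by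
    rw [eLpNorm_one_eq_lintegral_enorm, ← ofReal_integral_norm_eq_lintegral_enorm
      (hg.integrable_of_hasCompactSupport hχc'.mul_right)]
    simp [abs_of_nonneg (hχ _).1]
  have i1 : Integrable (fun y ↦ χ y * ‖f y‖ ^ 2) ν :=
    Continuous.integrable_of_hasCompactSupport (by fun_prop) hχc.mul_right
  have i2 : Integrable (fun y ↦ χ y * ‖f y‖) ν :=
    Continuous.integrable_of_hasCompactSupport (by fun_prop) hχc.mul_right
  have n2 : 0 ≤ ∫ y, χ y * ‖f y‖ ∂ν :=
    integral_nonneg fun y ↦ mul_nonneg (hχ y).1 (norm_nonneg _)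
  rw [e1, e2, ← ofReal_norm, Complex.norm_real, ← ENNReal.ofReal_coe_nnreal,
    ← ENNReal.ofReal_mul C.coe_nonneg, ENNReal.ofReal_le_ofReal_iff (by positivity)] at h1
  have h2 := (Real.le_norm_self _).trans h1
  have h3 : 0 < ∫ y, χ y * ‖f y‖ * (‖f y‖ - C) ∂ν := by
    refine Continuous.integral_pos_of_hasCompactSupport_nonneg_nonzero (x := x₀) (by fun_prop)
      hχc.mul_right.mul_right (fun y ↦ ?_) ?_
    · by_cases hy : C < ‖f y‖₊
      · exact mul_nonneg (mul_nonneg (hχ y).1 (norm_nonneg _)) (sub_nonneg.2 hy.le)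
      · simp [hχ0 (show y ∈ {x | C < ‖f x‖₊}ᶜ from hy)]
    · have hx' : (C : ℝ) < ‖f x₀‖ := hx
      have : 0 < ‖f x₀‖ := C.coe_nonneg.trans_lt hx'
      rw [hχ1 rfl, Pi.one_apply, one_mul]
      exact (mul_pos this (sub_pos.2 hx')).ne'
  have h4 : ∫ y, χ y * ‖f y‖ * (‖f y‖ - C) ∂ν
      = ∫ y, χ y * ‖f y‖ ^ 2 ∂ν - C * ∫ y, χ y * ‖f y‖ ∂ν := by
    rw [← integral_const_mul, ← integral_sub i1 (i2.const_mul _)]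
    congr 1 with y
    ring
  linarith

/-- Equality case of Hölder, truncated by a cutoff `χ`. With `A = ∫ χ|f|^q` the hypothesis gives `A
≤ C A^{1/p}`; compact support makes `A` finite, so one may divide and get `A^{1/q} ≤ C`. -/
lemma eLpNorm_le_of_forall_integral_mul_le {f : E → ℂ}
    (hf : Continuous f) {p q : ℝ≥0∞} [hpq : p.HolderConjugate q] (hq : 2 ≤ q) (hq' : q ≠ ∞)
    {C : ℝ≥0∞} (h : ∀ g : E → ℂ, Continuous g → HasCompactSupport g →
      ‖∫ y, g y * f y ∂ν‖ₑ ≤ C * eLpNorm g p ν) :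
    eLpNorm f q ν ≤ C := by
  have hq1 : 1 < q := lt_of_lt_of_le (by norm_num) hq
  have hp' : p ≠ ∞ := by
    rintro rfl
    exact hq1.ne' (ENNReal.HolderConjugate.unique ∞ q 1)
  have hp0 : p ≠ 0 := (zero_lt_one.trans_le (ENNReal.HolderConjugate.one_le p q)).ne'
  have hr : p.toReal.HolderConjugate q.toReal :=
    ENNReal.HolderConjugate.toReal_of_ne_top hp' hq'
  have hr2 : 2 ≤ q.toReal := by simpa using ENNReal.toReal_mono hq' hq
  have key : ∀ χ : C(E, ℝ), HasCompactSupport χ → (∀ x, χ x ∈ Set.Icc (0 : ℝ) 1) →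
      ∫⁻ y, ENNReal.ofReal (χ y) * ‖f y‖ₑ ^ q.toReal ∂ν ≤ C ^ q.toReal := by
    intro χ hχc hχ
    set A := ∫⁻ y, ENNReal.ofReal (χ y) * ‖f y‖ₑ ^ q.toReal ∂ν with hA
    have hχc' : HasCompactSupport fun y ↦ (χ y : ℂ) := hχc.comp_left (g := ((↑) : ℝ → ℂ)) rfl
    -- `w f = |f|^q` and `|w|^p = |f|^q`; `q ≥ 2` makes `w` continuous where `f` vanishes.
    set w : E → ℂ := fun y ↦ ((‖f y‖ ^ (q.toReal - 2) : ℝ) : ℂ) * (starRingEnd ℂ) (f y) with hw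
    have hwc : Continuous w := by
      have : Continuous fun y ↦ ‖f y‖ ^ (q.toReal - 2) :=
        hf.norm.rpow_const fun _ ↦ .inr (by linarith)
      fun_prop
    have hwf : ∀ y, w y * f y = ((‖f y‖ ^ q.toReal : ℝ) : ℂ) := by
      intro y
      rw [hw]
      dsimp only
      rw [mul_assoc, Complex.conj_mul', ← Complex.ofReal_pow, ← Complex.ofReal_mul,
        ← Real.rpow_natCast, ← Real.rpow_add_of_nonneg (norm_nonneg _) (by linarith) (by norm_num)]
      norm_num
    have hwn : ∀ y, ‖w y‖ₑ ^ p.toReal = ‖f y‖ₑ ^ q.toReal := by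
      intro y
      have : ‖w y‖ₑ = ‖f y‖ₑ ^ (q.toReal - 1) := by
        rw [hw]
        dsimp only
        rw [enorm_mul, RCLike.enorm_conj, ← ofReal_norm (_ : ℂ), Complex.norm_real,
          Real.norm_of_nonneg (by positivity), ← ENNReal.ofReal_rpow_of_nonneg (norm_nonneg _)
          (by linarith), ofReal_norm]
        nth_rw 2 [← ENNReal.rpow_one ‖f y‖ₑ]
        rw [← ENNReal.rpow_add_of_nonneg _ _ (by linarith) (by norm_num)]
        congr 1
        ring
      rw [this, ← ENNReal.rpow_mul, hr.symm.sub_one_mul_conj]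
    have h1 := h (fun y ↦ (χ y : ℂ) * w y) (by fun_prop) hχc'.mul_right
    have i1 : Integrable (fun y ↦ χ y * ‖f y‖ ^ q.toReal) ν :=
      Continuous.integrable_of_hasCompactSupport
        (χ.continuous.mul (hf.norm.rpow_const fun _ ↦ .inr (by linarith))) hχc.mul_right
    have hnn : ∀ y, 0 ≤ χ y * ‖f y‖ ^ q.toReal := fun y ↦ mul_nonneg (hχ y).1 (by positivity)
    have hA' : A = ENNReal.ofReal (∫ y, χ y * ‖f y‖ ^ q.toReal ∂ν) := by
      rw [ofReal_integral_eq_lintegral_ofReal i1 (.of_forall hnn), hA]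
      congr 1 with y
      rw [ENNReal.ofReal_mul (hχ y).1, ← ENNReal.ofReal_rpow_of_nonneg (norm_nonneg _)
        (by linarith), ofReal_norm]
    have e1 : ‖∫ y, (χ y : ℂ) * w y * f y ∂ν‖ₑ = A := by
      simp_rw [mul_assoc, hwf, ← Complex.ofReal_mul]
      rw [integral_complex_ofReal, ← ofReal_norm, Complex.norm_real,
        Real.norm_of_nonneg (integral_nonneg hnn), hA']
    have e2 : eLpNorm (fun y ↦ (χ y : ℂ) * w y) p ν ≤ A ^ (1 / p.toReal) := by
      rw [eLpNorm_eq_lintegral_rpow_enorm_toReal hp0 hp']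
      refine ENNReal.rpow_le_rpow (lintegral_mono fun y ↦ ?_) (by positivity)
      rw [enorm_mul, ENNReal.mul_rpow_of_nonneg _ _ hr.nonneg, hwn, ← ofReal_norm (_ : ℂ),
        Complex.norm_real, Real.norm_of_nonneg (hχ y).1]
      gcongr
      -- `χ^p ≤ χ`, as `0 ≤ χ ≤ 1` and `p ≥ 1`.
      exact (ENNReal.rpow_le_rpow_of_exponent_ge (ENNReal.ofReal_le_one.2 (hχ y).2)
        hr.lt.le).trans_eq (ENNReal.rpow_one _)
    rw [e1] at h1
    have h2 : A ≤ C * A ^ (1 / p.toReal) := h1.trans (by gcongr)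
    rcases eq_or_ne A 0 with h0 | h0
    · simp [h0]
    have hAt : A ≠ ∞ := hA' ▸ ENNReal.ofReal_ne_top
    have hsplit : A = A ^ (1 / q.toReal) * A ^ (1 / p.toReal) := by
      rw [← ENNReal.rpow_add _ _ h0 hAt, add_comm, one_div, one_div, hr.inv_add_inv_eq_one,
        ENNReal.rpow_one]
    nth_rw 1 [hsplit] at h2
    have h3 : A ^ (1 / q.toReal) ≤ C :=
      (ENNReal.mul_le_mul_iff_left (ENNReal.rpow_pos (pos_iff_ne_zero.2 h0) hAt).ne'
        (ENNReal.rpow_ne_top_of_nonneg (by positivity) hAt)).1 h2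
    rw [one_div] at h3
    exact (ENNReal.rpow_inv_le_iff hr.symm.pos).1 h3
  rw [eLpNorm_eq_lintegral_rpow_enorm_toReal (zero_lt_one.trans hq1).ne' hq', one_div,
    ENNReal.rpow_inv_le_iff hr.symm.pos]
  -- The bound on `A` is uniform in `χ`, so the truncation is removed by exhausting the space with
  -- balls on which `χ = 1`.
  have hcov : AECover ν Filter.atTop fun k : ℕ ↦ Metric.closedBall (0 : E) k :=
    aecover_closedBall tendsto_natCast_atTop_atTop
  refine le_of_tendsto (hcov.lintegral_tendsto_of_countably_generated
    (hf.enorm.measurable.pow_const _).aemeasurable) (.of_forall fun k ↦ ?_)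
  obtain ⟨χ, hχ1, -, hχc, hχ⟩ := exists_continuous_one_zero_of_isCompact
    (isCompact_closedBall (0 : E) k) isClosed_empty (Set.disjoint_empty _)
  refine le_trans ?_ (key χ hχc hχ)
  rw [← lintegral_indicator measurableSet_closedBall]
  refine lintegral_mono fun y ↦ ?_
  by_cases hy : y ∈ Metric.closedBall (0 : E) k
  · simp [Set.indicator_of_mem hy, hχ1 hy]
  · simp [Set.indicator_of_notMem hy]

end

/-! ### Transforms of Schwartz functions as competitors for the dual norm -/

lemma fourier_fourier_apply {n : ℕ} (φ : 𝓢(RSpace n, ℂ)) (x : RSpace n) :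
    𝓕 (𝓕 φ) x = φ (-x) := by
  have h : (𝓕⁻ (𝓕 φ) : 𝓢(RSpace n, ℂ)) (-x) = φ (-x) := by
    rw [FourierTransform.fourierInv_fourier_eq]
  rwa [SchwartzMap.fourierInv_coe, Real.fourierInv_eq_fourier_neg, neg_neg,
    ← SchwartzMap.fourier_coe] at h

lemma hatNorm_fourier_le {n : ℕ} {p q : ℝ≥0∞} (hq : ENNReal.conjExponent q = p)
    (φ : 𝓢(RSpace n, ℂ)) : hatNorm q (𝓕 φ : 𝓢(RSpace n, ℂ)) ≤ eLpNorm φ p volume := by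
  refine iInf₂_le_of_le (𝓕 (𝓕 φ) : 𝓢(RSpace n, ℂ)) 
    ⟨SchwartzMap.memLp _ _ volume, fun ψ ↦ ?_⟩ ?_
  · exact SchwartzMap.integral_fourier_mul_eq (𝓕 φ) ψ
  · have : ⇑(𝓕 (𝓕 φ) : 𝓢(RSpace n, ℂ)) = φ ∘ Neg.neg := funext (fourier_fourier_apply φ)
    rw [this, hq, eLpNorm_comp_measurePreserving φ.continuous.aestronglyMeasurable
      (Measure.measurePreserving_neg volume)]

lemma memHatLp_fourier {n : ℕ} (q : ℝ≥0∞) (φ : 𝓢(RSpace n, ℂ)) :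
    MemHatLp q (𝓕 φ : 𝓢(RSpace n, ℂ)) :=
  ⟨SchwartzMap.memLp _ _ volume, φ, φ.memLp _, SchwartzMap.integral_fourier_mul_eq φ⟩

lemma integrable_exp_inner {n : ℕ} (ρ : Measure (RSpace n)) [IsFiniteMeasure ρ] (y : RSpace n) :
    Integrable (fun x ↦ Complex.exp (-(2 * π * inner ℝ x y : ℝ) * Complex.I)) ρ := by
  refine Integrable.of_bound (C := 1) (Continuous.aestronglyMeasurable (by fun_prop))
    (.of_forall fun x ↦ ?_)
  rw [← Complex.ofReal_neg, Complex.norm_exp_ofReal_mul_I]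

lemma continuous_integral_exp_inner {n : ℕ} (ρ : Measure (RSpace n)) [IsFiniteMeasure ρ] :
    Continuous fun y : RSpace n ↦
      ∫ x, Complex.exp (-(2 * π * inner ℝ x y : ℝ) * Complex.I) ∂ρ := by
  refine continuous_of_dominated (bound := fun _ ↦ 1)
    (fun y ↦ (integrable_exp_inner ρ y).aestronglyMeasurable)
    (fun y ↦ .of_forall fun x ↦ ?_) (integrable_const _) (.of_forall fun x ↦ by fun_prop)
  rw [← Complex.ofReal_neg, Complex.norm_exp_ofReal_mul_I]

lemma continuous_fourierMeasure {n : ℕ} (μ : ComplexMeasure (RSpace n)) :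
    Continuous (fourierMeasure μ) := by
  obtain ⟨ρ, c, hρ, h⟩ := exists_cintegral_eq μ
  have : fourierMeasure μ = fun y ↦ ∑ i,
      (∫ x, Complex.exp (-(2 * π * inner ℝ x y : ℝ) * Complex.I) ∂ρ i) * c i :=
    funext fun y ↦ (h _ fun i ↦ integrable_exp_inner (ρ i) y).2
  rw [this]
  exact continuous_finsetSum _ fun i _ ↦
    (continuous_integral_exp_inner (ρ i)).mul continuous_const

/-- Fubini, in the form of the multiplication formula for the pair of measures `volume` and `ρ`,
applied to `φ` and the constant `1`. -/
lemma integral_fourier_eq_integral_mul {n : ℕ} (ρ : Measure (RSpace n)) [IsFiniteMeasure ρ]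
    (φ : 𝓢(RSpace n, ℂ)) :
    ∫ x, (𝓕 φ : 𝓢(RSpace n, ℂ)) x ∂ρ =
      ∫ y, φ y * ∫ x, Complex.exp (-(2 * π * inner ℝ x y : ℝ) * Complex.I) ∂ρ := by
  have h := VectorFourier.integral_fourierIntegral_smul_eq_flip (μ := volume) (ν := ρ)
    (f := φ) (g := fun _ ↦ (1 : ℂ)) (L := innerₗ (RSpace n)) continuous_fourierChar
    continuous_inner φ.integrable (integrable_const _)
  simp only [smul_eq_mul, mul_one] at h
  rw [SchwartzMap.fourier_coe]
  refine h.trans (integral_congr_ae (.of_forall fun y ↦ ?_))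
  simp [VectorFourier.fourierIntegral, Circle.smul_def, Real.fourierChar_apply]

lemma cintegral_fourier {n : ℕ} (μ : ComplexMeasure (RSpace n)) (φ : 𝓢(RSpace n, ℂ)) :
    VectorMeasure.Integrable μ (𝓕 φ : 𝓢(RSpace n, ℂ)) ∧
      cintegral μ (𝓕 φ : 𝓢(RSpace n, ℂ)) = ∫ y, φ y * fourierMeasure μ y := by
  obtain ⟨ρ, c, hρ, h⟩ := exists_cintegral_eq μ
  have hint : ∀ i, Integrable (𝓕 φ : 𝓢(RSpace n, ℂ)) (ρ i) := fun i ↦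
    Integrable.of_bound (C := SchwartzMap.seminorm ℝ 0 0 (𝓕 φ))
      (𝓕 φ : 𝓢(RSpace n, ℂ)).continuous.aestronglyMeasurable
      (.of_forall fun x ↦ SchwartzMap.norm_le_seminorm ℝ _ x)
  refine ⟨(h _ hint).1, ?_⟩
  rw [(h _ hint).2]
  have : ∀ y, fourierMeasure μ y = ∑ i,
      (∫ x, Complex.exp (-(2 * π * inner ℝ x y : ℝ) * Complex.I) ∂ρ i) * c i :=
    fun y ↦ (h _ fun i ↦ integrable_exp_inner (ρ i) y).2
  simp_rw [this, Finset.mul_sum, ← mul_assoc]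
  rw [integral_finsetSum]
  · simp_rw [integral_mul_const, integral_fourier_eq_integral_mul]
  · intro i _
    refine Integrable.mul_const ?_ _
    refine φ.integrable.mul_bdd (c := (ρ i).real Set.univ) ?_ (.of_forall fun y ↦ ?_)
    · exact (continuous_integral_exp_inner (ρ i)).aestronglyMeasurable
    · refine (norm_integral_le_of_norm_le_const (C := 1) (.of_forall fun x ↦ ?_)).trans_eq
        (one_mul _)
      rw [← Complex.ofReal_neg, Complex.norm_exp_ofReal_mul_I]

lemma enorm_integral_mul_fourierMeasure_le_starNorm {n : ℕ} {p : ℝ≥0∞} (hp : 1 ≤ p)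
    (μ : ComplexMeasure (RSpace n)) {φ : 𝓢(RSpace n, ℂ)} (hφ : eLpNorm φ p volume ≤ 1) :
    ‖∫ y, φ y * fourierMeasure μ y‖ₑ ≤ starNorm p μ := by
  have hpq : p.HolderConjugate (ENNReal.conjExponent p) := .conjExponent hp
  have hconj : ENNReal.conjExponent (ENNReal.conjExponent p) = p := hpq.symm.conjExponent_eq
  obtain ⟨hi, he⟩ := cintegral_fourier μ φ
  rw [← he]
  exact le_iSup₂_of_le (f := fun (h : RSpace n → ℂ) _ ↦ ‖cintegral μ h‖ₑ)
    (𝓕 φ : 𝓢(RSpace n, ℂ)) ⟨SchwartzMap.continuous _, hi, memHatLp_fourier _ _,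
      (hatNorm_fourier_le hconj φ).trans hφ⟩ le_rfl

lemma enorm_integral_mul_fourierMeasure_le {n : ℕ} {p : ℝ≥0∞} (hp : 1 ≤ p)
    (μ : ComplexMeasure (RSpace n)) (φ : 𝓢(RSpace n, ℂ)) :
    ‖∫ y, φ y * fourierMeasure μ y‖ₑ ≤ starNorm p μ * eLpNorm φ p volume := by
  set N := eLpNorm φ p volume with hN
  have hNt : N ≠ ∞ := (φ.memLp p volume).eLpNorm_ne_top
  rcases eq_or_ne N 0 with h0 | h0
  · have hφ : φ =ᵐ[volume] (0 : RSpace n → ℂ) := (eLpNorm_eq_zero_iff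
      φ.continuous.aestronglyMeasurable (zero_lt_one.trans_le hp).ne').1 h0
    have : ∫ y, φ y * fourierMeasure μ y = 0 := by
      refine integral_eq_zero_of_ae ?_
      filter_upwards [hφ] with y hy
      simp [hy]
    simp [this]
  -- Homogeneity: `φ` is scaled to unit `L^p` norm.
  set c : ℂ := (N.toReal : ℂ)⁻¹ with hc
  have hcN : ‖c‖ₑ = N⁻¹ := by
    rw [hc, enorm_inv (by simp [ENNReal.toReal_eq_zero_iff, h0, hNt]), ← ofReal_norm,
      Complex.norm_real, Real.norm_of_nonneg ENNReal.toReal_nonneg, ENNReal.ofReal_toReal hNt]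
  have h1 : eLpNorm (c • φ) p volume ≤ 1 := by
    rw [show ⇑(c • φ) = c • ⇑φ from rfl, eLpNorm_const_smul, hcN,
      ENNReal.inv_mul_cancel h0 hNt]
  have h2 := enorm_integral_mul_fourierMeasure_le_starNorm hp μ h1
  simp only [smul_apply, smul_eq_mul, mul_assoc] at h2
  rw [integral_const_mul, enorm_mul, hcN, mul_comm, ← div_eq_mul_inv] at h2
  exact (ENNReal.div_le_iff h0 hNt).1 h2

theorem mainTheorem3 (n : ℕ) (p : ℝ≥0∞) (hp1 : 1 ≤ p) (hp2 : p ≤ 2)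
    (μ : ComplexMeasure (RSpace n)) (hμ : μ ∈ MSpace n p) :
    MemLp (fourierMeasure μ) (ENNReal.conjExponent p) volume ∧
      eLpNorm (fourierMeasure μ) (ENNReal.conjExponent p) volume ≤ starNorm p μ := by
  have hpq : p.HolderConjugate (ENNReal.conjExponent p) := .conjExponent hp1
  have hcont := continuous_fourierMeasure μ
  have hfin : starNorm p μ < ∞ := hμ
  have hdual : ∀ g : RSpace n → ℂ, Continuous g → HasCompactSupport g →
      ‖∫ y, g y * fourierMeasure μ y‖ₑ ≤ starNorm p μ * eLpNorm g p volume :=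
    fun g hg hgc ↦ enorm_integral_mul_le_of_forall_schwartz hcont hp1
      (hp2.trans_lt ENNReal.ofNat_lt_top).ne hfin.ne
      (enorm_integral_mul_fourierMeasure_le hp1 μ) hg hgc
  have hle : eLpNorm (fourierMeasure μ) (ENNReal.conjExponent p) volume ≤ starNorm p μ := by
    rcases eq_or_ne p 1 with rfl | hp
    · have : ENNReal.conjExponent 1 = ∞ := by simp [ENNReal.conjExponent]
      rw [this]
      exact eLpNorm_top_le_of_forall_integral_mul_le hcont hdual
    · refine eLpNorm_le_of_forall_integral_mul_le hcont ?_ ?_ hdual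
      -- `p' = 1 + (p - 1)⁻¹ ≥ 2` because `p - 1 ≤ 1`.
      · rw [ENNReal.conjExponent, ← one_add_one_eq_two]
        gcongr
        rw [ENNReal.one_le_inv, tsub_le_iff_right, one_add_one_eq_two]
        exact hp2
      · have : p - 1 ≠ 0 := (tsub_pos_of_lt (hp1.lt_of_ne' hp)).ne'
        simp [ENNReal.conjExponent, this]
  exact ⟨⟨hcont.aestronglyMeasurable, hle.trans_lt hfin⟩, hle⟩
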